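/- Identify $M_2(\mathbb C)^{\otimes (N+1)}=M_2(\mathbb C)\otimes M_2(\mathbb C)^{\otimes N}$ and write $X=\sum_{i,j=1}^2 e_{ij}\otimes X_{ij}$ with $X_{ij}\in M_2(\mathbb C)^{\otimes N}$. Define linear maps $\Psi_N: M_2(\mathbb C)^{\otimes N}\to M_2(\mathbb C)^{\otimes N}$ recursively by $\Psi_0=0$ and $$\Psi_{N+1}\begin{pmatrix}X_{11}&X_{12}\\X_{21}&X_{22}\end{pmatrix}=\frac1{2^N}\begin{pmatrix}(\operatorname{Tr}X-\operatorname{Tr}X_{11})\mathbb 1&-(X_{12}+\Psi_N(X_{21}))\\-(X_{21}+\Psi_N(X_{12}))&(\operatorname{Tr}X-\operatorname{Tr}X_{22})\mathbb 1\end{pmatrix}.$$ Put $d=2^N$, $\phi^+=\sum_{i=1}^{d}e_i\otimes e_i$, $P^+=\frac1d|\phi^+\rangle\langle\phi^+|$ and $W_N=(\mathcal I\otimes\Psi_N)P^+$, where $\mathcal I$ is the identity map on $M_2(\mathbb C)^{\otimes N}$. The structural physical approximation (SPA) of $W_N$ is $W_N(p_*)$, where $W_N(p)=\frac{p}{d^2}\,\mathbb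 1\otimes\mathbb 1+(1-p)W_N$ and $p_*$ is the smallest $p\in[0,1]$ for which $W_N(p)\ge 0$. The SPA of $\Psi_N$ is $\widetilde\Psi_N(p_*)$, where $\widetilde\Psi_N(p)(X)=p\,\frac{\operatorname{Tr}X}{d}\mathbb 1+(1-p)\Psi_N(X)$ and $p_*$ is the smallest $p\in[0,1]$ for which $\widetilde\Psi_N(p)$ is completely positive. A bipartite state is separable if it is a convex combination of product states. A channel (completely positive trace-preserving map) $\mathcal E$ is entanglement breaking if $(\mathcal I_k\otimes\mathcal E)\rho$ is separable for every $k\ge 1$ and every state $\rho$ of the input system and a $k$-dimensional ancilla, where $\mathcal I_k$ is the identity map on $M_k(\mathbb C)$. Then for every $N\ge1$: 1. $\Psi_N$ is unital, and $W_N$ is Hermitian with exactly one negative eigenvalue, namely $-\frac1{2^N}$, which is simple with eigenvector $\phi^+$. 2. The SPA of $W_N$ exists and is a separable state. 3. The SPA of $\Psi_N$ exists and is an entanglement-breaking channel $\mathcal E$, and $(\mathcal I\otimes\mathcal E)P^+$ is the SPA of $W_N$. -/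

import Mathlib

open scoped Kronecker Matrix ComplexOrder

noncomputable section

/-- Labels of the standard product basis of the `N`-fold tensor power of `ℂ²`.  Thus
`Matrix (Qubits N) (Qubits N) ℂ` is the `N`-fold tensor power of the `2 × 2` complex matrices. -/
abbrev Qubits (N : ℕ) : Type := Fin N → Fin 2

/-- The block `X_{ij}` of `X = ∑ i j, e_{ij} ⊗ X_{ij}`, where the first tensor factor is
split off. -/
def block {N : ℕ} (X : Matrix (Qubits (N + 1)) (Qubits (N + 1)) ℂ) (i j : Fin 2) :
    Matrix (Qubits N) (Qubits N) ℂ :=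
  Matrix.of fun s t => X (Fin.cons i s) (Fin.cons j t)

/-- The matrix `∑ i j, e_{ij} ⊗ B_{ij}` with prescribed blocks `B_{ij}`. -/
def assemble {N : ℕ} (B : Matrix (Fin 2) (Fin 2) (Matrix (Qubits N) (Qubits N) ℂ)) :
    Matrix (Qubits (N + 1)) (Qubits (N + 1)) ℂ :=
  Matrix.of fun s t => B (s 0) (t 0) (Fin.tail s) (Fin.tail t)

/-- The recursive family of maps: `Ψ_0 = 0`, and `Ψ_{N+1}(X)` is `2^{-N}` times the block matrix
with diagonal blocks `(Tr X - Tr X_{ii}) 1` and off-diagonal blocks `-(X_{12} + Ψ_N(X_{21}))`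
and `-(X_{21} + Ψ_N(X_{12}))`. -/
def Psi : (N : ℕ) → Matrix (Qubits N) (Qubits N) ℂ →ₗ[ℂ] Matrix (Qubits N) (Qubits N) ℂ
  | 0 => 0
  | N + 1 =>
    { toFun := fun X => ((1 : ℂ) / 2 ^ N) • assemble
        !![(X.trace - (block X 0 0).trace) • 1, -(block X 0 1 + Psi N (block X 1 0));
           -(block X 1 0 + Psi N (block X 0 1)), (X.trace - (block X 1 1).trace) • 1]
      map_add' := by
        intro X Y
        have hb : ∀ i j, block (X + Y) i j = block X i j + block Y i j := fun i j => rfl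
        ext s t
        simp only [hb, assemble, Matrix.smul_apply, Matrix.add_apply, Matrix.of_apply]
        generalize s 0 = a
        generalize t 0 = b
        fin_cases a <;> fin_cases b <;> simp [Matrix.trace_add] <;> ring
      map_smul' := by
        intro c X
        have hb : ∀ i j, block (c • X) i j = c • block X i j := fun i j => rfl
        ext s t
        simp only [hb, assemble, Matrix.smul_apply, Matrix.of_apply]
        generalize s 0 = a
        generalize t 0 = b
        fin_cases a <;> fin_cases b <;> simp [Matrix.trace_smul] <;> ring }

section General

variable {m n : Type*} [Fintype m] [DecidableEq m] [Fintype n] [DecidableEq n]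

/-- The map `𝓘 ⊗ Λ`, where `𝓘` is the identity map on the matrices indexed by `k`. -/
def idTensor (k : Type*) (Λ : Matrix m m ℂ →ₗ[ℂ] Matrix n n ℂ) (Z : Matrix (k × m) (k × m) ℂ) :
    Matrix (k × n) (k × n) ℂ :=
  Matrix.of fun x y => Λ (Matrix.of fun i j => Z (x.1, i) (y.1, j)) x.2 y.2

/-- The unnormalized maximally entangled vector `∑ i, e_i ⊗ e_i`. -/
def phiPlus (m : Type*) [DecidableEq m] : m × m → ℂ := fun x => if x.1 = x.2 then 1 else 0

/-- The maximally entangled state: the normalized projector onto `∑ i, e_i ⊗ e_i`. -/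
def maxEntangled (m : Type*) [Fintype m] [DecidableEq m] : Matrix (m × m) (m × m) ℂ :=
  ((1 : ℂ) / Fintype.card m) • Matrix.vecMulVec (phiPlus m) (star (phiPlus m))

/-- The bipartite operator `(𝓘 ⊗ Λ) P⁺` of a linear map `Λ`. -/
def witness (Λ : Matrix m m ℂ →ₗ[ℂ] Matrix n n ℂ) : Matrix (m × n) (m × n) ℂ :=
  idTensor m Λ (maxEntangled m)

/-- A (mixed) quantum state, i.e. a density matrix. -/
def IsState (ρ : Matrix m m ℂ) : Prop := ρ.PosSemidef ∧ ρ.trace = 1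

/-- A separable bipartite state: a state that is a finite sum of tensor products of positive
semidefinite matrices (equivalently, a finite convex combination of product states). -/
def IsSeparableState (ρ : Matrix (m × n) (m × n) ℂ) : Prop :=
  IsState ρ ∧ ∃ (r : ℕ) (A : Fin r → Matrix m m ℂ) (B : Fin r → Matrix n n ℂ),
    (∀ i, (A i).PosSemidef) ∧ (∀ i, (B i).PosSemidef) ∧ ρ = ∑ i, A i ⊗ₖ B i

/-- Complete positivity: `𝓘_k ⊗ Λ` preserves positive semidefiniteness for all `k`. -/
def IsCompletelyPositive (Λ : Matrix m m ℂ →ₗ[ℂ] Matrix n n ℂ) : Prop :=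
  ∀ (k : ℕ) (Z : Matrix (Fin k × m) (Fin k × m) ℂ),
    Z.PosSemidef → (idTensor (Fin k) Λ Z).PosSemidef

/-- A quantum channel: a completely positive trace-preserving map. -/
def IsChannel (Λ : Matrix m m ℂ →ₗ[ℂ] Matrix n n ℂ) : Prop :=
  IsCompletelyPositive Λ ∧ ∀ X, (Λ X).trace = X.trace

/-- An entanglement-breaking channel: a channel such that `(𝓘 ⊗ Λ) ρ` is separable for every
state `ρ` of the input system and an ancilla of arbitrary finite dimension. -/
def IsEntanglementBreakingChannel (Λ : Matrix m m ℂ →ₗ[ℂ] Matrix n n ℂ) : Prop :=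
  IsChannel Λ ∧ ∀ (k : ℕ) (ρ : Matrix (Fin k × m) (Fin k × m) ℂ),
    IsState ρ → IsSeparableState (idTensor (Fin k) Λ ρ)

/-- The completely depolarizing channel `X ↦ Tr(X) 1 / d`. -/
def depolarizing (m : Type*) [Fintype m] [DecidableEq m] : Matrix m m ℂ →ₗ[ℂ] Matrix m m ℂ :=
  ((1 : ℂ) / Fintype.card m) • (Matrix.traceLinearMap m ℂ ℂ).smulRight (1 : Matrix m m ℂ)

/-- The mixture of weight `p` of the completely depolarizing channel with the map `Λ`. -/
def mixMap (Λ : Matrix m m ℂ →ₗ[ℂ] Matrix m m ℂ) (p : ℝ) : Matrix m m ℂ →ₗ[ℂ] Matrix m m ℂ :=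
  (p : ℂ) • depolarizing m + (1 - (p : ℂ)) • Λ

/-- The mixture of weight `p` of the maximally mixed state with the bipartite operator `W`. -/
def mixWitness (W : Matrix (m × n) (m × n) ℂ) (p : ℝ) : Matrix (m × n) (m × n) ℂ :=
  ((p : ℂ) / (Fintype.card m * Fintype.card n)) • ((1 : Matrix m m ℂ) ⊗ₖ (1 : Matrix n n ℂ))
    + (1 - (p : ℂ)) • W

/-- `E` is the structural physical approximation of the map `Λ`: the member of the family
`mixMap Λ p` for the smallest `p ∈ [0, 1]` that makes it completely positive. -/
def IsMapSPA (Λ E : Matrix m m ℂ →ₗ[ℂ] Matrix m m ℂ) : Prop :=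
  ∃ p : ℝ, IsLeast {q : ℝ | q ∈ Set.Icc 0 1 ∧ IsCompletelyPositive (mixMap Λ q)} p ∧
    E = mixMap Λ p

/-- `σ` is the structural physical approximation of the bipartite operator `W`: the member of the
family `mixWitness W p` for the smallest `p ∈ [0, 1]` that makes it positive semidefinite. -/
def IsWitnessSPA (W σ : Matrix (m × n) (m × n) ℂ) : Prop :=
  ∃ p : ℝ, IsLeast {q : ℝ | q ∈ Set.Icc 0 1 ∧ (mixWitness W q).PosSemidef} p ∧
    σ = mixWitness W p

end General

end

/-!
Write `d = 2 ^ N` and let `P_r` run through the `4 ^ N` Pauli strings.  The map `Ψ_N` is diagonal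
with respect to them in two ways: there are real weights `c r` with

* `Ψ_N X = d⁻¹ ∑ r, c r • P_r X P_r` (`Psi_eq_sum_mul_mul`),
* `Ψ_N X = -d⁻¹ ∑ r, c r • Tr (P_r X) • P_r` (`Psi_eq_sum_trace_smul`).

Both follow by induction from the block recursion, with the same weights.  For `N ≥ 1` the identity
string has weight `-1`, all other weights are nonnegative, and the weights sum to `d`.

The first form says that the witness is `d⁻² ∑ r, c r • |β_r⟩⟨β_r|` for the orthogonal vectors
`β_r = ∑ i, e_i ⊗ P_r e_i`.  Only `β_0 = φ⁺` carries a negative weight; this gives the spectral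
claims, as well as unitality and trace preservation, and it shows that the mixtures of weight `p`
are not positive for `p < d / (d + 1)` (`spaWeight_le_of_posSemidef`).

The second form shows that at `p = d / (d + 1)` the mixture of maps is, up to a positive factor,
`Tr X • 1 + Ψ_N X = d⁻¹ ∑ r, c r • (Tr X • 1 - Tr (P_r X) • P_r)`, where the term of the identity
string vanishes.  Each of the other terms is the map which measures the sign of `P_r` and prepares
the opposite sign (`mixMap_Psi_eq_sum`).  Such a measure-and-prepare map is entanglement breaking
and its Choi operator is separable, so the lower bound on `p` is attained.
-/

/-! ### Blocks -/

section Blocks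

variable {N : ℕ}

theorem block_ext {X Y : Matrix (Qubits (N + 1)) (Qubits (N + 1)) ℂ}
    (h : ∀ i j, block X i j = block Y i j) : X = Y := by
  ext s t
  have := congrFun (congrFun (h (s 0) (t 0)) (Fin.tail s)) (Fin.tail t)
  simpa [block] using this

theorem block_add (X Y : Matrix (Qubits (N + 1)) (Qubits (N + 1)) ℂ) (i j : Fin 2) :
    block (X + Y) i j = block X i j + block Y i j := rfl

theorem block_smul (c : ℂ) (X : Matrix (Qubits (N + 1)) (Qubits (N + 1)) ℂ) (i j : Fin 2) :
    block (c • X) i j = c • block X i j := rfl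

theorem block_sum {ι : Type*} (s : Finset ι)
    (X : ι → Matrix (Qubits (N + 1)) (Qubits (N + 1)) ℂ) (i j : Fin 2) :
    block (∑ a ∈ s, X a) i j = ∑ a ∈ s, block (X a) i j := by
  ext u v
  simp [block, Matrix.sum_apply]

theorem block_assemble (B : Matrix (Fin 2) (Fin 2) (Matrix (Qubits N) (Qubits N) ℂ))
    (i j : Fin 2) : block (assemble B) i j = B i j := by
  ext u v
  simp [block, assemble]

theorem sum_eq_sum_cons {α M : Type*} [Fintype α] [AddCommMonoid M] (f : (Fin (N + 1) → α) → M) :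
    ∑ r, f r = ∑ r : Fin N → α, ∑ a, f (Fin.cons a r) := by
  rw [← (Fin.consEquiv fun _ => α).sum_comp, Fintype.sum_prod_type_right]
  rfl

theorem block_mul (X Y : Matrix (Qubits (N + 1)) (Qubits (N + 1)) ℂ) (i j : Fin 2) :
    block (X * Y) i j = block X i 0 * block Y 0 j + block X i 1 * block Y 1 j := by
  ext u v
  simp [block, Matrix.mul_apply, sum_eq_sum_cons, Finset.sum_add_distrib]

theorem trace_eq_block (X : Matrix (Qubits (N + 1)) (Qubits (N + 1)) ℂ) :
    X.trace = (block X 0 0).trace + (block X 1 1).trace := by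
  simp [block, Matrix.trace, sum_eq_sum_cons, Finset.sum_add_distrib]

theorem block_one (i j : Fin 2) :
    block (1 : Matrix (Qubits (N + 1)) (Qubits (N + 1)) ℂ) i j = if i = j then 1 else 0 := by
  ext u v
  fin_cases i <;> fin_cases j <;> simp [block, Matrix.one_apply]

theorem Psi_succ (X : Matrix (Qubits (N + 1)) (Qubits (N + 1)) ℂ) :
    Psi (N + 1) X = ((1 : ℂ) / 2 ^ N) • assemble
        !![(X.trace - (block X 0 0).trace) • 1, -(block X 0 1 + Psi N (block X 1 0));
           -(block X 1 0 + Psi N (block X 0 1)), (X.trace - (block X 1 1).trace) • 1] := rfl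

end Blocks

/-! ### Pauli strings -/

/-- The Pauli matrices, in the order `1, σ_x, σ_y, σ_z`. -/
def pauliMatrix : Fin 4 → Matrix (Fin 2) (Fin 2) ℂ :=
  ![1, !![0, 1; 1, 0], !![0, -Complex.I; Complex.I, 0], !![1, 0; 0, -1]]

/-- The tensor product `σ_{r 0} ⊗ ⋯ ⊗ σ_{r (N - 1)}` of Pauli matrices. -/
def pauliString : (N : ℕ) → (Fin N → Fin 4) → Matrix (Qubits N) (Qubits N) ℂ
  | 0, _ => 1
  | N + 1, r => assemble (Matrix.of fun i j =>
      pauliMatrix (r 0) i j • pauliString N (Fin.tail r))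

/-- The weight `c r` of the Pauli string `P_r` in `Ψ_N X = 2⁻ᴺ ∑ r, c r • P_r X P_r`, defined by
the recursion which the block formula for `Ψ_{N+1}` imposes on it. -/
noncomputable def pauliWeight : (N : ℕ) → (Fin N → Fin 4) → ℝ
  | 0, _ => 0
  | N + 1, r =>
    ![-(if Fin.tail r = 0 then 1 else 0), (1 - pauliWeight N (Fin.tail r)) / 2 ^ N,
      (1 + pauliWeight N (Fin.tail r)) / 2 ^ N, if Fin.tail r = 0 then 1 else 0] (r 0)

section Pauli

variable {N : ℕ}

theorem block_pauliString (a : Fin 4) (r : Fin N → Fin 4) (i j : Fin 2) :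
    block (pauliString (N + 1) (Fin.cons a r)) i j = pauliMatrix a i j • pauliString N r := by
  simp [pauliString, block_assemble]

theorem pauliString_zero : ∀ N : ℕ, pauliString N 0 = 1
  | 0 => rfl
  | N + 1 => by
    have h : (0 : Fin (N + 1) → Fin 4) = Fin.cons 0 0 := by
      ext i; refine Fin.cases rfl (fun _ => rfl) i
    refine block_ext fun i j => ?_
    rw [h, block_pauliString, pauliString_zero N, block_one]
    fin_cases i <;> fin_cases j <;> simp [pauliMatrix]

theorem isHermitian_pauliString : ∀ {N : ℕ} (r : Fin N → Fin 4), (pauliString N r).IsHermitian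
  | 0, _ => Matrix.isHermitian_one
  | N + 1, r => by
    have hb : ∀ (X : Matrix (Qubits (N + 1)) (Qubits (N + 1)) ℂ) (i j : Fin 2),
        block Xᴴ i j = (block X j i)ᴴ := fun _ _ _ => rfl
    rw [← Fin.cons_self_tail r]
    refine block_ext fun i j => ?_
    rw [hb, block_pauliString, block_pauliString, Matrix.conjTranspose_smul,
      (isHermitian_pauliString _).eq]
    congr 1
    generalize r 0 = a
    fin_cases a <;> fin_cases i <;> fin_cases j <;> simp [pauliMatrix]

theorem pauliString_mul_self : ∀ {N : ℕ} (r : Fin N → Fin 4),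
    pauliString N r * pauliString N r = 1
  | 0, _ => one_mul 1
  | N + 1, r => by
    rw [← Fin.cons_self_tail r]
    refine block_ext fun i j => ?_
    rw [block_mul, block_one]
    simp only [block_pauliString, smul_mul_smul_comm, pauliString_mul_self]
    generalize r 0 = a
    fin_cases a <;> fin_cases i <;> fin_cases j <;> simp [pauliMatrix]

theorem cons_eq_zero_iff {a : Fin 4} {r : Fin N → Fin 4} :
    (Fin.cons a r : Fin (N + 1) → Fin 4) = 0 ↔ a = 0 ∧ r = 0 := by
  simp [funext_iff, Fin.forall_fin_succ]

theorem trace_pauliString : ∀ {N : ℕ} (r : Fin N → Fin 4),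
    (pauliString N r).trace = if r = 0 then 2 ^ N else 0
  | 0, r => by simp [pauliString, Subsingleton.elim r 0]
  | N + 1, r => by
    rw [← Fin.cons_self_tail r, trace_eq_block]
    simp only [block_pauliString, Matrix.trace_smul, trace_pauliString, cons_eq_zero_iff]
    generalize r 0 = a
    by_cases h0 : Fin.tail r = 0 <;> fin_cases a <;> (simp [pauliMatrix, h0]; try ring)

/-- The Pauli strings satisfy the completeness relation of an orthogonal basis. -/
theorem sum_trace_pauliString_smul : ∀ {N : ℕ} (X : Matrix (Qubits N) (Qubits N) ℂ),
    ∑ r, (pauliString N r * X).trace • pauliString N r = (2 : ℂ) ^ N • X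
  | 0, X => by
    ext s t
    simp [pauliString, Matrix.trace, Subsingleton.elim s t]
    congr <;> exact Subsingleton.elim _ _
  | N + 1, X => by
    refine block_ext fun i j => ?_
    rw [block_smul, pow_succ', mul_smul, ← sum_trace_pauliString_smul, sum_eq_sum_cons, block_sum,
      Finset.smul_sum]
    refine Finset.sum_congr rfl fun r _ => ?_
    rw [Fin.sum_univ_four]
    simp only [block_add, block_smul, block_pauliString, trace_eq_block, block_mul,
      Matrix.trace_add, Matrix.smul_mul, Matrix.trace_smul, smul_smul, ← add_smul]
    congr 1
    fin_cases i <;> fin_cases j <;> simp [pauliMatrix] <;> ring_nf <;> simp <;> ring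

/-- Averaging over conjugation by all Pauli strings is the completely depolarizing map. -/
theorem sum_pauliString_mul_mul : ∀ {N : ℕ} (X : Matrix (Qubits N) (Qubits N) ℂ),
    ∑ r, pauliString N r * X * pauliString N r = ((2 : ℂ) ^ N * X.trace) • 1
  | 0, X => by
    ext s t
    simp [pauliString, Matrix.trace, Subsingleton.elim s t]
    congr <;> exact Subsingleton.elim _ _
  | N + 1, X => by
    refine block_ext fun i j => ?_
    have key : ∑ r, block (∑ a, pauliString (N + 1) (Fin.cons a r) * X *
        pauliString (N + 1) (Fin.cons a r)) i j =
        ∑ r, pauliString N r * (if i = j then (2 : ℂ) • (block X 0 0 + block X 1 1) else 0) *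
          pauliString N r := by
      refine Finset.sum_congr rfl fun r _ => ?_
      rw [Fin.sum_univ_four]
      simp only [block_add, block_pauliString, block_mul, Matrix.smul_mul, Matrix.mul_smul]
      fin_cases i <;> fin_cases j <;>
        simp [pauliMatrix, smul_smul, mul_add, add_mul] <;> module
    rw [sum_eq_sum_cons, block_sum, key, sum_pauliString_mul_mul, block_smul, block_one,
      trace_eq_block]
    split_ifs
    · rw [Matrix.trace_smul, Matrix.trace_add, smul_eq_mul, pow_succ]
      congr 1
      ring
    · simp

theorem sum_ite_smul_pauli (f : (Fin N → Fin 4) → Matrix (Qubits N) (Qubits N) ℂ) :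
    ∑ r, (if r = 0 then (1 : ℂ) else 0) • f r = f 0 := by
  simp [ite_smul]

/-- The Kraus-type form of `Ψ_N`.  In the diagonal blocks the strings beginning with `1` and `σ_z`
cancel and those beginning with `σ_x` and `σ_y` add up to a depolarizing map, because their weights
have a sum independent of the tail.  In the off-diagonal blocks the former give `X_{ij}` and the
latter, where only the difference of the weights survives, give `Ψ_{N-1} X_{ji}`. -/
theorem Psi_eq_sum_mul_mul : ∀ {N : ℕ} (X : Matrix (Qubits N) (Qubits N) ℂ),
    (2 : ℂ) ^ N • Psi N X =
      ∑ r, (pauliWeight N r : ℂ) • (pauliString N r * X * pauliString N r)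
  | 0, X => by simp [Psi, pauliWeight]
  | N + 1, X => by
    have h2 : (2 : ℂ) ^ N ≠ 0 := by positivity
    refine block_ext fun i j => ?_
    rw [sum_eq_sum_cons, block_sum]
    simp only [Fin.sum_univ_four, pauliWeight, Fin.tail_cons, Fin.cons_zero, block_add, block_smul,
      block_pauliString, block_mul, Matrix.smul_mul, Matrix.mul_smul, Psi_succ, block_assemble]
    fin_cases i <;> fin_cases j
    · trans ∑ r, ((2 : ℂ) / 2 ^ N) • (pauliString N r * block X 1 1 * pauliString N r)
      · rw [← Finset.smul_sum, sum_pauliString_mul_mul, trace_eq_block]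
        simp only [Fin.zero_eta, Matrix.of_apply, Matrix.cons_val, smul_smul]
        congr 1
        field_simp
        ring
      · refine Finset.sum_congr rfl fun r _ => ?_
        by_cases h0 : r = 0 <;> simp [pauliMatrix, h0, smul_smul, pauliString_zero] <;> module
    · trans ∑ r, ((-2 : ℂ) • (if r = 0 then (1 : ℂ) else 0) •
          (pauliString N r * block X 0 1 * pauliString N r) + (-2 / 2 ^ N : ℂ) •
          (pauliWeight N r : ℂ) • (pauliString N r * block X 1 0 * pauliString N r))
      · rw [Finset.sum_add_distrib, ← Finset.smul_sum, ← Finset.smul_sum, ← Psi_eq_sum_mul_mul,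
          sum_ite_smul_pauli, pauliString_zero, one_mul, mul_one, pow_succ]
        simp only [Fin.zero_eta, Fin.mk_one, Matrix.of_apply, Matrix.cons_val, smul_smul, smul_neg,
          smul_add]
        match_scalars <;> field_simp
      · refine Finset.sum_congr rfl fun r _ => ?_
        by_cases h0 : r = 0 <;>
          simp [pauliMatrix, h0, smul_smul, pauliString_zero] <;> module
    · trans ∑ r, ((-2 : ℂ) • (if r = 0 then (1 : ℂ) else 0) •
          (pauliString N r * block X 1 0 * pauliString N r) + (-2 / 2 ^ N : ℂ) •
          (pauliWeight N r : ℂ) • (pauliString N r * block X 0 1 * pauliString N r))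
      · rw [Finset.sum_add_distrib, ← Finset.smul_sum, ← Finset.smul_sum, ← Psi_eq_sum_mul_mul,
          sum_ite_smul_pauli, pauliString_zero, one_mul, mul_one, pow_succ]
        simp only [Fin.zero_eta, Fin.mk_one, Matrix.of_apply, Matrix.cons_val, smul_smul, smul_neg,
          smul_add]
        match_scalars <;> field_simp
      · refine Finset.sum_congr rfl fun r _ => ?_
        by_cases h0 : r = 0 <;>
          simp [pauliMatrix, h0, smul_smul, pauliString_zero] <;> module
    · trans ∑ r, ((2 : ℂ) / 2 ^ N) • (pauliString N r * block X 0 0 * pauliString N r)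
      · rw [← Finset.smul_sum, sum_pauliString_mul_mul, trace_eq_block]
        simp only [Fin.mk_one, Matrix.of_apply, Matrix.cons_val, smul_smul]
        congr 1
        field_simp
        ring
      · refine Finset.sum_congr rfl fun r _ => ?_
        by_cases h0 : r = 0 <;> simp [pauliMatrix, h0, smul_smul, pauliString_zero] <;> module

/-- The expansion of `Ψ_N` in Pauli strings.  Strings beginning with `1` and `σ_z` contribute only
to the diagonal blocks, those beginning with `σ_x` and `σ_y` only to the off-diagonal ones, where
the constant part of their weights gives `X_{ij}` and the other part `Ψ_{N-1} X_{ji}`. -/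
theorem Psi_eq_sum_trace_smul : ∀ {N : ℕ} (X : Matrix (Qubits N) (Qubits N) ℂ),
    (2 : ℂ) ^ N • Psi N X =
      -∑ r, (pauliWeight N r : ℂ) • (pauliString N r * X).trace • pauliString N r
  | 0, X => by simp [Psi, pauliWeight]
  | N + 1, X => by
    have h2 : (2 : ℂ) ^ N ≠ 0 := by positivity
    have hn : ∀ Y : Matrix (Qubits (N + 1)) (Qubits (N + 1)) ℂ, ∀ i j,
        block (-Y) i j = -block Y i j := fun _ _ _ => rfl
    refine block_ext fun i j => ?_
    rw [sum_eq_sum_cons, hn, block_sum]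
    simp only [Fin.sum_univ_four, pauliWeight, Fin.tail_cons, Fin.cons_zero, block_add, block_smul,
      block_pauliString, block_mul, Matrix.smul_mul, Psi_succ, block_assemble,
      trace_eq_block (pauliString _ _ * _), Matrix.trace_add, Matrix.trace_smul]
    fin_cases i <;> fin_cases j
    · trans -∑ r, (-2 : ℂ) • (if r = 0 then (1 : ℂ) else 0) •
          (pauliString N r * block X 1 1).trace • pauliString N r
      · rw [← Finset.smul_sum, sum_ite_smul_pauli, pauliString_zero, one_mul, trace_eq_block,
          pow_succ]
        simp only [Fin.zero_eta, Matrix.of_apply, Matrix.cons_val, smul_smul]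
        match_scalars
        field_simp
        ring
      · congr 1
        refine Finset.sum_congr rfl fun r _ => ?_
        by_cases h0 : r = 0 <;>
          (simp [pauliMatrix, h0, smul_smul, pauliString_zero]; try module)
    · trans -∑ r, ((2 / 2 ^ N : ℂ) • (pauliString N r * block X 0 1).trace • pauliString N r +
          (-2 / 2 ^ N : ℂ) • (pauliWeight N r : ℂ) •
            (pauliString N r * block X 1 0).trace • pauliString N r)
      · rw [Finset.sum_add_distrib, ← Finset.smul_sum, ← Finset.smul_sum,
          sum_trace_pauliString_smul, ← neg_neg (∑ r, (pauliWeight N r : ℂ) • _),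
          ← Psi_eq_sum_trace_smul, pow_succ]
        simp only [Fin.zero_eta, Fin.mk_one, Matrix.of_apply, Matrix.cons_val, smul_smul, smul_neg,
          smul_add]
        match_scalars <;> field_simp
      · congr 1
        refine Finset.sum_congr rfl fun r _ => ?_
        by_cases h0 : r = 0 <;>
          (simp [pauliMatrix, h0, smul_smul, pauliString_zero]
           match_scalars
           ring_nf
           simp only [Complex.I_sq]
           ring)
    · trans -∑ r, ((2 / 2 ^ N : ℂ) • (pauliString N r * block X 1 0).trace • pauliString N r +
          (-2 / 2 ^ N : ℂ) • (pauliWeight N r : ℂ) •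
            (pauliString N r * block X 0 1).trace • pauliString N r)
      · rw [Finset.sum_add_distrib, ← Finset.smul_sum, ← Finset.smul_sum,
          sum_trace_pauliString_smul, ← neg_neg (∑ r, (pauliWeight N r : ℂ) • _),
          ← Psi_eq_sum_trace_smul, pow_succ]
        simp only [Fin.zero_eta, Fin.mk_one, Matrix.of_apply, Matrix.cons_val, smul_smul, smul_neg,
          smul_add]
        match_scalars <;> field_simp
      · congr 1
        refine Finset.sum_congr rfl fun r _ => ?_
        by_cases h0 : r = 0 <;>
          (simp [pauliMatrix, h0, smul_smul, pauliString_zero]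
           match_scalars
           ring_nf
           simp only [Complex.I_sq]
           ring)
    · trans -∑ r, (-2 : ℂ) • (if r = 0 then (1 : ℂ) else 0) •
          (pauliString N r * block X 0 0).trace • pauliString N r
      · rw [← Finset.smul_sum, sum_ite_smul_pauli, pauliString_zero, one_mul, trace_eq_block,
          pow_succ]
        simp only [Fin.mk_one, Matrix.of_apply, Matrix.cons_val, smul_smul]
        match_scalars
        field_simp
        ring
      · congr 1
        refine Finset.sum_congr rfl fun r _ => ?_
        by_cases h0 : r = 0 <;>
          (simp [pauliMatrix, h0, smul_smul, pauliString_zero]; try module)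

theorem pauliWeight_succ_zero (N : ℕ) : pauliWeight (N + 1) 0 = -1 := by
  have : Fin.tail (0 : Fin (N + 1) → Fin 4) = 0 := rfl
  simp [pauliWeight, this]

theorem abs_pauliWeight_le_one : ∀ {N : ℕ} (r : Fin N → Fin 4), |pauliWeight N r| ≤ 1
  | 0, _ => by simp [pauliWeight]
  | N + 1, r => by
    have h := abs_le.1 (abs_pauliWeight_le_one (Fin.tail r))
    have key : |pauliWeight N (Fin.tail r)| + 1 ≤ 2 ^ N := by
      cases N with
      | zero => simp [pauliWeight]
      | succ N =>
        have := abs_pauliWeight_le_one (Fin.tail r)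
        have : (1 : ℝ) ≤ 2 ^ N := one_le_pow₀ (by norm_num)
        rw [pow_succ]
        linarith
    have h2 : (0 : ℝ) < 2 ^ N := by positivity
    have h3 := neg_abs_le (pauliWeight N (Fin.tail r))
    have h4 := le_abs_self (pauliWeight N (Fin.tail r))
    rw [pauliWeight]
    generalize r 0 = a
    fin_cases a
    · by_cases h0 : Fin.tail r = 0 <;> simp [h0]
    · simp only [Fin.mk_one, Matrix.cons_val_one, Matrix.cons_val_zero]
      rw [abs_div, abs_of_nonneg (by linarith), abs_of_pos h2, div_le_one h2]
      linarith
    · simp only [Fin.reduceFinMk, Matrix.cons_val]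
      rw [abs_div, abs_of_nonneg (by linarith), abs_of_pos h2, div_le_one h2]
      linarith
    · by_cases h0 : Fin.tail r = 0 <;> simp [h0]

/-- No string other than the identity has negative weight. -/
theorem pauliWeight_nonneg : ∀ {N : ℕ} {r : Fin N → Fin 4}, r ≠ 0 → 0 ≤ pauliWeight N r
  | 0, _, _ => le_rfl
  | N + 1, r, hr => by
    have h := abs_le.1 (abs_pauliWeight_le_one (Fin.tail r))
    rw [pauliWeight]
    rw [← Fin.cons_self_tail r, Ne, cons_eq_zero_iff] at hr
    generalize r 0 = a at *
    have hx := div_nonneg (sub_nonneg.2 h.2) (by positivity : (0 : ℝ) ≤ 2 ^ N)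
    have hy := div_nonneg (neg_le_iff_add_nonneg'.1 h.1) (by positivity : (0 : ℝ) ≤ 2 ^ N)
    by_cases h0 : Fin.tail r = 0 <;> fin_cases a <;> simp_all

theorem sum_pauliWeight (N : ℕ) : ∑ r, pauliWeight (N + 1) r = 2 ^ (N + 1) := by
  simp only [sum_eq_sum_cons, Fin.sum_univ_four, pauliWeight, Fin.tail_cons, Fin.cons_zero]
  trans ∑ _r : Fin N → Fin 4, (2 : ℝ) / 2 ^ N
  · refine Finset.sum_congr rfl fun r _ => ?_
    simp only [Matrix.cons_val]
    ring
  · have h4 : (4 : ℝ) ^ N = 2 ^ N * 2 ^ N := by rw [← mul_pow]; norm_num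
    simp [h4, pow_succ]
    field_simp

end Pauli

/-! ### Maps of measure-and-prepare form -/

section MeasurePrepare

variable {k m n ι : Type*} [Fintype m] [Fintype ι]

open scoped MatrixOrder Matrix.Norms.L2Operator in
/-- Measuring an effect `F` on the second subsystem leaves a positive operator on the first. -/
theorem posSemidef_trace_mul_slice [Fintype k] {F : Matrix m m ℂ} (hF : F.PosSemidef)
    {Z : Matrix (k × m) (k × m) ℂ} (hZ : Z.PosSemidef) :
    (Matrix.of fun x y => (F * Matrix.of fun i j => Z (x, i) (y, j)).trace).PosSemidef := by
  classical
  obtain ⟨G, rfl⟩ := CStarAlgebra.nonneg_iff_eq_star_mul_self.mp hF.nonneg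
  -- The rows of `G`, tensored with the identity of the first subsystem.
  let K : m → Matrix k (k × m) ℂ := fun l => Matrix.of fun x z => if x = z.1 then G l z.2 else 0
  convert Matrix.posSemidef_sum Finset.univ fun l _ => hZ.mul_mul_conjTranspose_same (K l)
  ext x y
  simp only [Matrix.trace, Matrix.diag, Matrix.mul_apply, Matrix.of_apply, Matrix.star_apply,
    Matrix.conjTranspose_apply, Matrix.sum_apply, Fintype.sum_prod_type, K, ite_mul, zero_mul,
    Finset.sum_mul, apply_ite star, star_zero, mul_ite, mul_zero, Finset.sum_ite_irrel,
    Finset.sum_const_zero, Finset.sum_ite_eq, Finset.mem_univ, if_true]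
  rw [Finset.sum_congr rfl fun _ _ => Finset.sum_comm, Finset.sum_comm]
  refine Finset.sum_congr rfl fun l _ => Finset.sum_congr rfl fun i _ =>
    Finset.sum_congr rfl fun j _ => ?_
  ring

theorem idTensor_eq_sum_kronecker {E : Matrix m m ℂ →ₗ[ℂ] Matrix n n ℂ} {F : ι → Matrix m m ℂ}
    {B : ι → Matrix n n ℂ} (hE : ∀ X, E X = ∑ c, (F c * X).trace • B c)
    (Z : Matrix (k × m) (k × m) ℂ) :
    idTensor k E Z = ∑ c,
      (Matrix.of fun x y => (F c * Matrix.of fun i j => Z (x, i) (y, j)).trace) ⊗ₖ B c := by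
  ext x y
  simp [idTensor, hE, Matrix.sum_apply]

theorem trace_idTensor [Fintype k] [Fintype n] {E : Matrix m m ℂ →ₗ[ℂ] Matrix n n ℂ}
    (hE : ∀ X, (E X).trace = X.trace)
    (Z : Matrix (k × m) (k × m) ℂ) : (idTensor k E Z).trace = Z.trace := by
  simp only [Matrix.trace, Matrix.diag, Fintype.sum_prod_type]
  exact Finset.sum_congr rfl fun x _ => hE (Matrix.of fun i j => Z (x, i) (x, j))

theorem posSemidef_idTensor [Fintype k] [Fintype n] {E : Matrix m m ℂ →ₗ[ℂ] Matrix n n ℂ}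
    {F : ι → Matrix m m ℂ} {B : ι → Matrix n n ℂ} (hE : ∀ X, E X = ∑ c, (F c * X).trace • B c)
    (hF : ∀ c, (F c).PosSemidef) (hB : ∀ c, (B c).PosSemidef)
    {Z : Matrix (k × m) (k × m) ℂ} (hZ : Z.PosSemidef) : (idTensor k E Z).PosSemidef := by
  rw [idTensor_eq_sum_kronecker hE]
  exact Matrix.posSemidef_sum _ fun c _ =>
    (posSemidef_trace_mul_slice (hF c) hZ).kronecker (hB c)

theorem isSeparableState_idTensor [Fintype k] [Fintype n] {E : Matrix m m ℂ →ₗ[ℂ] Matrix n n ℂ}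
    {F : ι → Matrix m m ℂ} {B : ι → Matrix n n ℂ} (hE : ∀ X, E X = ∑ c, (F c * X).trace • B c)
    (hF : ∀ c, (F c).PosSemidef) (hB : ∀ c, (B c).PosSemidef)
    (htr : ∀ X, (E X).trace = X.trace) {ρ : Matrix (k × m) (k × m) ℂ} (hρ : IsState ρ) :
    IsSeparableState (idTensor k E ρ) := by
  refine ⟨⟨posSemidef_idTensor hE hF hB hρ.1, (trace_idTensor htr ρ).trans hρ.2⟩,
    Fintype.card ι, _, _,
    fun i => posSemidef_trace_mul_slice (hF ((Fintype.equivFin ι).symm i)) hρ.1,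
    fun i => hB ((Fintype.equivFin ι).symm i), ?_⟩
  rw [idTensor_eq_sum_kronecker hE, ← (Fintype.equivFin ι).symm.sum_comp]

theorem isEntanglementBreakingChannel_of_eq_sum [Fintype n]
    {E : Matrix m m ℂ →ₗ[ℂ] Matrix n n ℂ} {F : ι → Matrix m m ℂ}
    {B : ι → Matrix n n ℂ} (hE : ∀ X, E X = ∑ c, (F c * X).trace • B c)
    (hF : ∀ c, (F c).PosSemidef) (hB : ∀ c, (B c).PosSemidef)
    (htr : ∀ X, (E X).trace = X.trace) : IsEntanglementBreakingChannel E :=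
  ⟨⟨fun _ _ hZ => posSemidef_idTensor hE hF hB hZ, htr⟩,
    fun _ _ hρ => isSeparableState_idTensor hE hF hB htr hρ⟩

end MeasurePrepare

/-! ### The maximally entangled state -/

section Witness

variable {m n : Type*} [Fintype m] [DecidableEq m]

theorem posSemidef_maxEntangled : (maxEntangled m).PosSemidef :=
  (Matrix.posSemidef_vecMulVec_self_star _).smul (by positivity)

theorem star_phiPlus_dotProduct_self :
    star (phiPlus m) ⬝ᵥ phiPlus m = Fintype.card m := by
  simp [dotProduct, phiPlus, Fintype.sum_prod_type, apply_ite star]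

theorem phiPlus_ne_zero [Nonempty m] : phiPlus m ≠ 0 := by
  intro h
  have := star_phiPlus_dotProduct_self (m := m)
  simp [h, eq_comm] at this

theorem isState_maxEntangled [Nonempty m] : IsState (maxEntangled m) := by
  refine ⟨posSemidef_maxEntangled, ?_⟩
  rw [maxEntangled, Matrix.trace_smul, Matrix.trace_vecMulVec, dotProduct_comm,
    star_phiPlus_dotProduct_self]
  simp

theorem witness_apply (Λ : Matrix m m ℂ →ₗ[ℂ] Matrix n n ℂ) (x y : m × n) :
    witness Λ x y = (1 / Fintype.card m : ℂ) * Λ (Matrix.single x.1 y.1 1) x.2 y.2 := by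
  have h : (Matrix.of fun i j => maxEntangled m (x.1, i) (y.1, j)) =
      (1 / Fintype.card m : ℂ) • Matrix.single x.1 y.1 1 := by
    ext i j
    by_cases hi : x.1 = i <;>
      simp [maxEntangled, Matrix.vecMulVec_apply, phiPlus, Matrix.single_apply, hi]
  rw [witness, idTensor, Matrix.of_apply, h, map_smul, Matrix.smul_apply, smul_eq_mul]

theorem witness_mixMap (Λ : Matrix m m ℂ →ₗ[ℂ] Matrix m m ℂ) (p : ℝ) :
    witness (mixMap Λ p) = mixWitness (witness Λ) p := by
  ext x y
  simp only [witness_apply, mixMap, mixWitness, depolarizing, Matrix.add_apply, Matrix.smul_apply,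
    LinearMap.add_apply, LinearMap.smul_apply, LinearMap.smulRight_apply, smul_eq_mul,
    Matrix.traceLinearMap_apply, Matrix.kroneckerMap_apply]
  by_cases h : x.1 = y.1 <;> by_cases h' : x.2 = y.2 <;> simp [Matrix.one_apply, h, h'] <;> ring

/-- One half of the Choi–Jamiołkowski criterion. -/
theorem IsCompletelyPositive.posSemidef_witness {Λ : Matrix m m ℂ →ₗ[ℂ] Matrix n n ℂ}
    (h : IsCompletelyPositive Λ) : (witness Λ).PosSemidef := by
  let e := Fintype.equivFin m
  have h1 := h _ _ (posSemidef_maxEntangled.submatrix (Prod.map e.symm id))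
  convert h1.submatrix (Prod.map e id)
  ext x y
  simp [witness, idTensor]

end Witness

/-! ### A negative direction of a Hermitian matrix -/

section Spectrum

variable {n : Type*} [Fintype n] {H : Matrix n n ℂ} {v : n → ℂ} {a b : ℝ}

theorem eq_zero_of_mulVec_eq_of_dotProduct_eq_zero
    (hpos : (H + (b : ℂ) • Matrix.vecMulVec v (star v)).PosSemidef) {μ : ℝ} (hμ : μ < 0)
    {u : n → ℂ} (hu : H *ᵥ u = (μ : ℂ) • u) (huv : star v ⬝ᵥ u = 0) : u = 0 := by
  have h := hpos.dotProduct_mulVec_nonneg u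
  rw [Matrix.add_mulVec, Matrix.smul_mulVec, Matrix.vecMulVec_mulVec, huv, hu] at h
  rw [MulOpposite.op_zero, zero_smul, smul_zero, add_zero, dotProduct_smul, smul_eq_mul] at h
  by_contra h0
  have h1 : 0 < star u ⬝ᵥ u := Matrix.dotProduct_star_self_pos_iff.2 h0
  exact (mul_neg_of_neg_of_pos (mod_cast hμ) h1).not_ge h

theorem dotProduct_eq_zero_of_mulVec_eq (hH : H.IsHermitian) (hv : H *ᵥ v = (a : ℂ) • v) {μ : ℂ}
    (hμ : μ ≠ a) {u : n → ℂ} (hu : H *ᵥ u = μ • u) : star v ⬝ᵥ u = 0 := by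
  have h : star v ⬝ᵥ (H *ᵥ u) = a * (star v ⬝ᵥ u) := by
    rw [Matrix.dotProduct_mulVec, ← hH.eq, ← Matrix.star_mulVec, hv]
    simp
  rw [hu, dotProduct_smul, smul_eq_mul] at h
  exact (mul_eq_zero.1 (by rw [sub_mul, h, sub_self] : (μ - a) * (star v ⬝ᵥ u) = 0)).resolve_left
    (sub_ne_zero.2 hμ)

theorem eigenspace_eq_span [DecidableEq n] (hv0 : v ≠ 0) (ha : a < 0)
    (hv : H *ᵥ v = (a : ℂ) • v) (hpos : (H + (b : ℂ) • Matrix.vecMulVec v (star v)).PosSemidef) :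
    Module.End.eigenspace (Matrix.toLin' H) (a : ℂ) = Submodule.span ℂ {v} := by
  refine le_antisymm (fun u hu => ?_) ?_
  · rw [Module.End.mem_eigenspace_iff, Matrix.toLin'_apply] at hu
    have h1 : star v ⬝ᵥ v ≠ 0 := fun h => hv0 (dotProduct_star_self_eq_zero.1 h)
    refine Submodule.mem_span_singleton.2 ⟨(star v ⬝ᵥ u) / (star v ⬝ᵥ v), Eq.symm ?_⟩
    rw [← sub_eq_zero]
    refine eq_zero_of_mulVec_eq_of_dotProduct_eq_zero hpos ha ?_ ?_
    · rw [Matrix.mulVec_sub, Matrix.mulVec_smul, hu, hv, smul_sub, smul_comm]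
    · rw [dotProduct_sub, dotProduct_smul, smul_eq_mul, div_mul_cancel₀ _ h1, sub_self]
  · rw [Submodule.span_singleton_le_iff_mem, Module.End.mem_eigenspace_iff, Matrix.toLin'_apply, hv]

theorem hasEigenvalue_iff_eq [DecidableEq n] (hH : H.IsHermitian) (hv0 : v ≠ 0)
    (hv : H *ᵥ v = (a : ℂ) • v) (hpos : (H + (b : ℂ) • Matrix.vecMulVec v (star v)).PosSemidef)
    {μ : ℝ} (hμ : μ < 0) :
    Module.End.HasEigenvalue (Matrix.toLin' H) (μ : ℂ) ↔ μ = a := by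
  constructor
  · intro h
    obtain ⟨u, hu, hu0⟩ := h.exists_hasEigenvector
    rw [Module.End.mem_eigenspace_iff, Matrix.toLin'_apply] at hu
    by_contra hne
    exact hu0 (eq_zero_of_mulVec_eq_of_dotProduct_eq_zero hpos hμ hu
      (dotProduct_eq_zero_of_mulVec_eq hH hv (mod_cast hne) hu))
  · rintro rfl
    exact Module.End.hasEigenvalue_of_hasEigenvector (x := v)
      ⟨Module.End.mem_eigenspace_iff.2 (by rw [Matrix.toLin'_apply, hv]), hv0⟩

theorem Matrix.PosSemidef.nonneg_of_mulVec_eq_smul (hH : H.PosSemidef) (hv0 : v ≠ 0)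
    (hv : H *ᵥ v = (a : ℂ) • v) : 0 ≤ a := by
  have h := hH.dotProduct_mulVec_nonneg v
  have h1 : 0 < star v ⬝ᵥ v := Matrix.dotProduct_star_self_pos_iff.2 hv0
  rw [hv, dotProduct_smul, smul_eq_mul] at h
  have h2 : (0 : ℂ) ≤ a := le_of_mul_le_mul_right (by rwa [zero_mul]) h1
  exact_mod_cast h2

end Spectrum

/-! ### The bipartite operator of `Ψ_N` -/

section PsiWitness

variable {N : ℕ}

/-- The vector `∑ i, e_i ⊗ P_r e_i` of the Bell-type basis attached to a Pauli string `P_r`. -/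
noncomputable def pauliVector (r : Fin N → Fin 4) : Qubits N × Qubits N → ℂ :=
  fun x => pauliString N r x.2 x.1

theorem pauliVector_zero : pauliVector (0 : Fin N → Fin 4) = phiPlus (Qubits N) := by
  ext x
  simp [pauliVector, pauliString_zero, phiPlus, Matrix.one_apply, eq_comm]

theorem star_pauliVector_dotProduct_phiPlus (r : Fin N → Fin 4) :
    star (pauliVector r) ⬝ᵥ phiPlus (Qubits N) = if r = 0 then 2 ^ N else 0 := by
  trans star (pauliString N r).trace
  · simp [dotProduct, phiPlus, pauliVector, Fintype.sum_prod_type, Matrix.trace]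
  · rw [trace_pauliString]
    split_ifs <;> simp

theorem witness_Psi_eq_sum (N : ℕ) :
    witness (Psi N) = ((1 / (2 ^ N * 2 ^ N) : ℝ) : ℂ) • ∑ r, (pauliWeight N r : ℂ) •
      Matrix.vecMulVec (pauliVector r) (star (pauliVector r)) := by
  have h2 : (2 : ℂ) ^ N ≠ 0 := by positivity
  ext x y
  rw [witness_apply, ← inv_smul_smul₀ h2 (Psi N _), Psi_eq_sum_mul_mul]
  simp only [Matrix.smul_apply, Matrix.sum_apply, Matrix.vecMulVec_apply, smul_eq_mul,
    Pi.star_apply, pauliVector]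
  have h (r : Fin N → Fin 4) :
      (pauliString N r * Matrix.single x.1 y.1 (1 : ℂ) * pauliString N r) x.2 y.2 =
        pauliString N r x.2 x.1 * star (pauliString N r y.2 y.1) := by
    rw [(isHermitian_pauliString r).apply]
    simp [Matrix.mul_apply, Matrix.single_apply, ite_and]
  simp only [h, ← mul_assoc]
  congr 1
  simp

theorem witness_Psi_mulVec_phiPlus (N : ℕ) :
    witness (Psi (N + 1)) *ᵥ phiPlus (Qubits (N + 1)) =
      ((-(1 / 2 ^ (N + 1)) : ℝ) : ℂ) • phiPlus (Qubits (N + 1)) := by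
  rw [witness_Psi_eq_sum, Matrix.smul_mulVec, Matrix.sum_mulVec, Finset.sum_eq_single 0]
  · rw [Matrix.smul_mulVec, Matrix.vecMulVec_mulVec, star_pauliVector_dotProduct_phiPlus,
      pauliVector_zero, pauliWeight_succ_zero]
    have h2 : (2 : ℂ) ^ (N + 1) ≠ 0 := by positivity
    ext x
    simp
    field_simp
  · intro r _ hr
    rw [Matrix.smul_mulVec, Matrix.vecMulVec_mulVec, star_pauliVector_dotProduct_phiPlus]
    simp [hr]
  · simp

/-- Adding a multiple of `|φ⁺⟩⟨φ⁺|` removes the only negative term of the witness. -/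
theorem posSemidef_witness_Psi_add (N : ℕ) :
    (witness (Psi (N + 1)) + ((1 / (2 ^ (N + 1) * 2 ^ (N + 1)) : ℝ) : ℂ) •
      Matrix.vecMulVec (phiPlus (Qubits (N + 1)))
        (star (phiPlus (Qubits (N + 1))))).PosSemidef := by
  rw [witness_Psi_eq_sum, ← smul_add, Fintype.sum_eq_add_sum_compl 0, pauliVector_zero,
    pauliWeight_succ_zero, Complex.ofReal_neg, Complex.ofReal_one, neg_smul, one_smul,
    neg_add_cancel_comm]
  refine (Matrix.posSemidef_sum _ fun r hr => ?_).smul (by positivity)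
  exact (Matrix.posSemidef_vecMulVec_self_star _).smul
    (mod_cast pauliWeight_nonneg (by simpa using hr))

theorem isHermitian_witness_Psi (N : ℕ) : (witness (Psi (N + 1))).IsHermitian := by
  have h := (posSemidef_witness_Psi_add N).isHermitian.sub
    ((Matrix.posSemidef_vecMulVec_self_star (phiPlus (Qubits (N + 1)))).smul
      (by positivity : (0 : ℝ) ≤ 1 / (2 ^ (N + 1) * 2 ^ (N + 1)))).isHermitian
  rwa [Complex.coe_smul, add_sub_cancel_right] at h

theorem Psi_one (N : ℕ) : Psi (N + 1) 1 = 1 := by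
  have h2 : (2 : ℂ) ^ (N + 1) ≠ 0 := by positivity
  rw [← inv_smul_smul₀ h2 (Psi _ _), Psi_eq_sum_mul_mul]
  simp only [mul_one, pauliString_mul_self]
  rw [← Finset.sum_smul, ← Complex.ofReal_sum, sum_pauliWeight, smul_smul]
  simp

theorem trace_Psi (X : Matrix (Qubits (N + 1)) (Qubits (N + 1)) ℂ) :
    (Psi (N + 1) X).trace = X.trace := by
  have h2 : (2 : ℂ) ^ (N + 1) ≠ 0 := by positivity
  rw [← inv_smul_smul₀ h2 (Psi _ _), Psi_eq_sum_mul_mul, Matrix.trace_smul, Matrix.trace_sum]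
  simp only [Matrix.trace_smul, Matrix.trace_mul_cycle, pauliString_mul_self, one_mul]
  rw [← Finset.sum_smul, ← Complex.ofReal_sum, sum_pauliWeight, smul_smul]
  simp

end PsiWitness

/-! ### The structural physical approximations -/

section SPA

/-- The critical weight `d / (d + 1)`, where `d = 2 ^ N`. -/
noncomputable def spaWeight (N : ℕ) : ℝ := 2 ^ N / (2 ^ N + 1)

theorem spaWeight_mem_Icc (N : ℕ) : spaWeight N ∈ Set.Icc 0 1 := by
  have : (0 : ℝ) < 2 ^ N := by positivity
  exact ⟨by unfold spaWeight; positivity, (div_le_one (by positivity)).2 (by linarith)⟩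

/-- The positive matrices `1 + P_r` and `1 - P_r`, which are twice the projectors onto the
eigenspaces of the Pauli string `P_r`, indexed by `r` and a choice of sign. -/
noncomputable def pauliEffect (N : ℕ) (c : (Fin N → Fin 4) × Bool) :
    Matrix (Qubits N) (Qubits N) ℂ :=
  if c.2 then 1 + pauliString N c.1 else 1 - pauliString N c.1

theorem posSemidef_pauliEffect {N : ℕ} (c : (Fin N → Fin 4) × Bool) :
    (pauliEffect N c).PosSemidef := by
  -- `1 ± P = (1 ± P)ᴴ (1 ± P) / 2` since `P` is a Hermitian involution.
  have h : pauliEffect N c = (1 / 2 : ℂ) • ((pauliEffect N c)ᴴ * pauliEffect N c) := by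
    have hs := pauliString_mul_self c.1
    unfold pauliEffect
    split_ifs
    · simp only [Matrix.conjTranspose_add, Matrix.conjTranspose_one,
        (isHermitian_pauliString c.1).eq, mul_add, add_mul, hs, one_mul, mul_one]
      module
    · simp only [Matrix.conjTranspose_sub, Matrix.conjTranspose_one,
        (isHermitian_pauliString c.1).eq, mul_sub, sub_mul, hs, one_mul, mul_one]
      module
  rw [h]
  exact (Matrix.posSemidef_conjTranspose_mul_self _).smul (by positivity)

/-- At the critical weight the mixture measures the sign of a Pauli string and prepares the
opposite sign, because `∑ r, c r = d` turns `Tr X • 1 + Ψ X` into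
`d⁻¹ ∑ r, c r • (Tr X • 1 - Tr (P_r X) • P_r)`.  Taking the absolute value of the weights makes all
operators positive and changes only the one of the identity string, whose term is zero. -/
theorem mixMap_Psi_eq_sum (N : ℕ) (X : Matrix (Qubits (N + 1)) (Qubits (N + 1)) ℂ) :
    mixMap (Psi (N + 1)) (spaWeight (N + 1)) X =
      ∑ c : (Fin (N + 1) → Fin 4) × Bool, (pauliEffect (N + 1) c * X).trace •
        (((|pauliWeight (N + 1) c.1| / (2 * 2 ^ (N + 1) * (2 ^ (N + 1) + 1)) : ℝ) : ℂ) •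
          pauliEffect (N + 1) (c.1, !c.2)) := by
  have h2 : (2 : ℂ) ^ (N + 1) ≠ 0 := by positivity
  have h3 : (2 : ℂ) ^ (N + 1) + 1 ≠ 0 := by exact_mod_cast (2 ^ (N + 1)).succ_ne_zero
  trans (1 / (2 ^ (N + 1) * (2 ^ (N + 1) + 1)) : ℂ) • ∑ r, (pauliWeight (N + 1) r : ℂ) •
    (X.trace • 1 - (pauliString (N + 1) r * X).trace • pauliString (N + 1) r)
  · simp only [smul_sub, Finset.sum_sub_distrib]
    rw [← Finset.sum_smul, ← Complex.ofReal_sum, sum_pauliWeight,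
      sub_eq_add_neg, ← smul_neg, ← Psi_eq_sum_trace_smul]
    simp only [mixMap, depolarizing, spaWeight, LinearMap.add_apply, LinearMap.smul_apply,
      LinearMap.smulRight_apply, Matrix.traceLinearMap_apply]
    simp only [Fintype.card_pi, Fintype.card_fin, Finset.prod_const, Finset.card_univ]
    push_cast
    match_scalars <;> field_simp
    ring
  · rw [Finset.smul_sum, Fintype.sum_prod_type]
    refine Finset.sum_congr rfl fun r _ => ?_
    by_cases hr : r = 0
    · simp [hr, pauliEffect, pauliString_zero]
    · simp only [abs_of_nonneg (pauliWeight_nonneg hr)]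
      simp [pauliEffect, add_mul, sub_mul, -Complex.coe_smul]
      match_scalars <;> field_simp <;> ring

theorem trace_mixMap_Psi (N : ℕ) (p : ℝ) (X : Matrix (Qubits (N + 1)) (Qubits (N + 1)) ℂ) :
    (mixMap (Psi (N + 1)) p X).trace = X.trace := by
  simp [mixMap, depolarizing, trace_Psi]
  field_simp
  ring

/-- The expectation of the mixture in `φ⁺` is nonnegative only from the critical weight on. -/
theorem spaWeight_le_of_posSemidef {N : ℕ} {q : ℝ}
    (h : (mixWitness (witness (Psi (N + 1))) q).PosSemidef) : spaWeight (N + 1) ≤ q := by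
  have h2 : (0 : ℝ) < 2 ^ (N + 1) := by positivity
  have hv : mixWitness (witness (Psi (N + 1))) q *ᵥ phiPlus (Qubits (N + 1)) =
      ((q / (2 ^ (N + 1) * 2 ^ (N + 1)) + (1 - q) * -(1 / 2 ^ (N + 1)) : ℝ) : ℂ) •
        phiPlus (Qubits (N + 1)) := by
    rw [mixWitness, Matrix.one_kronecker_one, Matrix.add_mulVec, Matrix.smul_mulVec,
      Matrix.smul_mulVec, Matrix.one_mulVec, witness_Psi_mulVec_phiPlus, smul_smul, ← add_smul]
    simp
  have h0 := h.nonneg_of_mulVec_eq_smul phiPlus_ne_zero hv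
  have h1 : q / (2 ^ (N + 1) * 2 ^ (N + 1)) + (1 - q) * -(1 / 2 ^ (N + 1)) =
      (q * (2 ^ (N + 1) + 1) - 2 ^ (N + 1)) / (2 ^ (N + 1) * 2 ^ (N + 1)) := by
    field_simp
    ring
  rw [h1, le_div_iff₀ (by positivity)] at h0
  rw [spaWeight, div_le_iff₀ (by positivity)]
  linarith

end SPA

theorem mainTheorem4 (N : ℕ) (hN : 1 ≤ N) :
    Psi N 1 = 1 ∧
    (witness (Psi N)).IsHermitian ∧
    (∀ μ : ℝ, μ < 0 →
      (Module.End.HasEigenvalue (Matrix.toLin' (witness (Psi N))) (μ : ℂ) ↔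
        μ = -(1 / 2 ^ N))) ∧
    Module.End.eigenspace (Matrix.toLin' (witness (Psi N))) (-(1 / 2 ^ N)) =
      Submodule.span ℂ {phiPlus (Qubits N)} ∧
    (∃ σ, IsWitnessSPA (witness (Psi N)) σ ∧ IsSeparableState σ) ∧
    (∃ E, IsMapSPA (Psi N) E ∧ IsEntanglementBreakingChannel E ∧
      IsWitnessSPA (witness (Psi N)) (witness E)) := by
  obtain ⟨N, rfl⟩ := Nat.exists_eq_add_of_le' hN
  have hH := isHermitian_witness_Psi N
  have hv := witness_Psi_mulVec_phiPlus N
  have hpos := posSemidef_witness_Psi_add N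
  have hB (c : (Fin (N + 1) → Fin 4) × Bool) :
      (((|pauliWeight (N + 1) c.1| / (2 * 2 ^ (N + 1) * (2 ^ (N + 1) + 1)) : ℝ) : ℂ) •
          pauliEffect (N + 1) (c.1, !c.2)).PosSemidef :=
    (posSemidef_pauliEffect _).smul
      (Complex.zero_le_real.2 (div_nonneg (abs_nonneg _) (by positivity)))
  have hEB : IsEntanglementBreakingChannel (mixMap (Psi (N + 1)) (spaWeight (N + 1))) :=
    isEntanglementBreakingChannel_of_eq_sum (mixMap_Psi_eq_sum N) posSemidef_pauliEffect hB
      (trace_mixMap_Psi N _)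
  have hsep : IsSeparableState (witness (mixMap (Psi (N + 1)) (spaWeight (N + 1)))) :=
    isSeparableState_idTensor (mixMap_Psi_eq_sum N) posSemidef_pauliEffect hB
      (trace_mixMap_Psi N _) isState_maxEntangled
  have hW : IsWitnessSPA (witness (Psi (N + 1)))
      (witness (mixMap (Psi (N + 1)) (spaWeight (N + 1)))) :=
    ⟨_, ⟨⟨spaWeight_mem_Icc _, witness_mixMap (Psi (N + 1)) _ ▸ hsep.1.1⟩,
      fun _ hq => spaWeight_le_of_posSemidef hq.2⟩, witness_mixMap _ _⟩
  refine ⟨Psi_one N, hH, fun μ hμ => hasEigenvalue_iff_eq hH phiPlus_ne_zero hv hpos hμ, ?_,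
    ⟨_, hW, hsep⟩, _, ⟨_, ⟨⟨spaWeight_mem_Icc _, hEB.1.1⟩, fun q hq => ?_⟩, rfl⟩, hEB, hW⟩
  · rw [← eigenspace_eq_span phiPlus_ne_zero (neg_neg_of_pos (by positivity)) hv hpos]
    simp
  · exact spaWeight_le_of_posSemidef (witness_mixMap (Psi (N + 1)) q ▸ hq.2.posSemidef_witness)
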